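/- A C-RASP formula (with causal masking) over a finite alphabet $\Gamma$ is built by $\varphi ::= Q_a \mid \neg\varphi \mid \varphi\wedge\varphi \mid t<t$ (with $a\in\Gamma$) and $t ::= c \mid \overleftarrow{\#}[\varphi] \mid t+t \mid t-t$ (with $c\in\mathbb Z$). It is interpreted at a position $i$ of a word $w\in\Gamma^*$: $Q_a$ says that position $i$ carries $a$, and $\overleftarrow{\#}[\varphi]$ is the number of positions $j\le i$ at which $\varphi$ holds. (For the empty word, formulas are evaluated at $i=0$, where every $Q_a$ is false and every count is $0$.) A CoT C-RASP over an input alphabet $\Sigma$ consists of a finite token alphabet $\Gamma\supseteq\Sigma$, a finite ordered list of rules $O_a\leftarrow\varphi$ with $a\in\Gamma$ and $\varphi$ a C-RASP formula over $\Gamma$, and a set $F\subseteq\Gamma$ of accepting tokens. On input $w\in\Sigma^*$ it starts with the context $w$ and repeatedly outputs, and appends to the context, the token $a$ of the first rule $O_a\leftarrow\varphi$ such that $\varphi$ holds at the last position of the current context; it halts if no rule applies. It accepts $w$ if at some point it outputs a token in $F$, and it recognizes the language of all $w\in\Sigma^*$ that it accepts. A language $L\subseteq\Sigma^*$ is permutation-invariant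 if for all $u,v\in\Sigma^*$ with the same Parikh vector (the same number of occurrences of every letter), $u\in L$ if and only if $v\in L$. Theorem. Let $\Sigma$ be a finite alphabet. Every recursively enumerable permutation-invariant language $L\subseteq\Sigma^*$ is recognized by a CoT C-RASP (with causal masking). In particular, CoT C-RASPs are Turing-complete over a unary alphabet: every recursively enumerable language $L\subseteq a^*$ is recognized by a CoT C-RASP. -/

import Mathlib

universe u

namespace CRASP

/-! C-RASP with causal masking, in its formula syntax (temporal logic with past counting). -/

mutual
/-- Boolean-valued C-RASP expressions over the alphabet `Γ`. The remaining Boolean connectives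
and comparisons (`⊤`, `∨`, `≤`, `=`, `>`, `≥`) are definable from these. -/
inductive Formula (Γ : Type u) : Type u
  /-- the current position carries the letter `a` -/
  | letter (a : Γ) : Formula Γ
  | neg (φ : Formula Γ) : Formula Γ
  | and (φ ψ : Formula Γ) : Formula Γ
  | lt (s t : Term Γ) : Formula Γ
/-- Count-valued C-RASP expressions over the alphabet `Γ`. -/
inductive Term (Γ : Type u) : Type u
  | const (c : ℤ) : Term Γ
  /-- the number of positions up to and including the current one where `φ` holds -/
  | count (φ : Formula Γ) : Term Γ
  | add (s t : Term Γ) : Term Γ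
  | sub (s t : Term Γ) : Term Γ
end

mutual
/-- `φ.Holds w i`: the formula `φ` holds in the word `w` at position `i`. Positions of `w` are
`1, …, w.length`. At `i = 0` (only relevant for the empty word) no letter predicate holds and all
counts are `0`. -/
noncomputable def Formula.Holds {Γ : Type u} : Formula Γ → List Γ → ℕ → Prop
  | .letter a, w, i => 1 ≤ i ∧ w[i - 1]? = some a
  | .neg φ, w, i => ¬ φ.Holds w i
  | .and φ ψ, w, i => φ.Holds w i ∧ ψ.Holds w i
  | .lt s t, w, i => s.val w i < t.val w i
/-- The value of a count-valued expression in the word `w` at position `i`. Counting is causally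
masked: only positions `j ≤ i` are counted. -/
noncomputable def Term.val {Γ : Type u} : Term Γ → List Γ → ℕ → ℤ
  | .const c, _, _ => c
  | .count φ, w, i => (Set.ncard {j : ℕ | 1 ≤ j ∧ j ≤ i ∧ φ.Holds w j} : ℤ)
  | .add s t, w, i => s.val w i + t.val w i
  | .sub s t, w, i => s.val w i - t.val w i
end

/-- A chain-of-thought C-RASP with input alphabet `α` and token alphabet `Γ ⊇ α` (the inclusion is
`embed`): a finite ordered list of rules `O_a ← φ`, and a set of accepting tokens. -/
structure CoT (α : Type*) (Γ : Type u) where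
  embed : α ↪ Γ
  rules : List (Γ × Formula Γ)
  accept : Set Γ

namespace CoT

variable {α : Type*} {Γ : Type u}

open Classical in
/-- The token output after the context `v`: the token of the first rule whose formula holds at the
last position of `v`; there is no output if no rule applies. -/
noncomputable def next (S : CoT α Γ) (v : List Γ) : Option Γ :=
  (S.rules.find? fun r => decide (r.2.Holds v v.length)).map Prod.fst

/-- One chain-of-thought step: the output token is appended to the context. -/
def Step (S : CoT α Γ) (v v' : List Γ) : Prop :=
  ∃ a, S.next v = some a ∧ v' = v ++ [a]

/-- `S` accepts `w` if, started on the context `w`, it outputs an accepting token at some point. -/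
def Accepts (S : CoT α Γ) (w : List α) : Prop :=
  ∃ v a, Relation.ReflTransGen S.Step (w.map S.embed) v ∧ S.next v = some a ∧ a ∈ S.accept

end CoT

/-- The language `L` over `α` is recognized by some CoT C-RASP with a finite token alphabet. -/
def IsRecognizable {α : Type*} (L : Language α) : Prop :=
  ∃ (Γ : Type) (_ : Finite Γ) (S : CoT α Γ), ∀ w : List α, w ∈ L ↔ S.Accepts w

end CRASP

/-- The Parikh vector of a word: the number of occurrences of each letter. -/
def parikh {α : Type*} [DecidableEq α] (w : List α) : α → ℕ := fun a => w.count a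

/-- Membership in `L` depends only on the Parikh vector. -/
def IsPermutationInvariant {α : Type*} [DecidableEq α] (L : Language α) : Prop :=
  ∀ u v : List α, parikh u = parikh v → (u ∈ L ↔ v ∈ L)

/-- Recursively enumerable languages over a finite alphabet (for a finite `α` the notion does not
depend on the chosen coding of letters). -/
def IsRE {α : Type*} [Primcodable α] (L : Language α) : Prop :=
  REPred fun w : List α => w ∈ L

-- C-RASP can determine the sign of any integer linear combination of the letter counts of the
-- context. Let the tokens be the control states of a counter machine, each weighted by the effect
-- of visiting it. Every counter is then a weighted letter count, its sign is definable, and the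
-- last token shows the state just visited. A chain of thought can therefore run the machine, with
-- the input letters acting as initial increments (`accepts_toCoT_iff`).
--
-- The machine sees only the Parikh vector of the input. By permutation invariance this suffices: it
-- may test a canonical word with the same counts. Membership of that word has the form ∃ k, R(k,
-- counts) with R primitive recursive (`IsRE.exists_code`). With arbitrarily many counters, loop
-- programs compute all primitive recursive functions (`computable_of_primrec`), and one while loop
-- searches for k (`exists_reaches_iff_exists_eq_zero`).

open StateTransition Function

-- Counter machines and structured programs

/-- A counter machine with integer counters indexed by `ℕ`. Visiting the control state `q` adds
`effect q` to the counters; then the sign of the counter `test q` selects the next state, where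
`none` means that the machine exits. -/
structure CounterMachine where
  State : Type
  finite : Finite State
  entry : State
  effect : State → ℕ → ℤ
  test : State → ℕ
  target : State → Bool → Option State

namespace CounterMachine

/-- A configuration: the control state to be visited next, and the counters. -/
abbrev Config (M : CounterMachine) : Type := Option M.State × (ℕ → ℤ)

/-- One step of a counter machine. -/
def step (M : CounterMachine) : M.Config → Option M.Config
  | (none, _) => none
  | (some q, s) =>
    some (M.target q (decide (0 < (s + M.effect q) (M.test q))), s + M.effect q)

/-- The configuration at control state `q` with natural counter values. -/
def config (M : CounterMachine) (q : Option M.State) (s : ℕ → ℕ) : M.Config :=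
  (q, fun r => (s r : ℤ))

/-- Started at its entry with counters `s`, the machine exits with counters `t`. -/
def Runs (M : CounterMachine) (s t : ℕ → ℕ) : Prop :=
  Reaches M.step (M.config (some M.entry) s) (M.config none t)

/-- Gluing principle behind composition and loops: `N` contains a copy of `M` whose exits are
redirected to `x`. -/
theorem Reaches.embed {M N : CounterMachine} (f : M.State → N.State) (x : Option N.State)
    (effect_eq : ∀ q, N.effect (f q) = M.effect q) (test_eq : ∀ q, N.test (f q) = M.test q)
    (target_eq : ∀ q b, N.target (f q) b = (M.target q b).elim x fun p => some (f p))
    {c d : M.Config} (h : Reaches M.step c d) :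
    Reaches N.step (c.1.elim x fun p => some (f p), c.2)
      (d.1.elim x fun p => some (f p), d.2) := by
  refine Relation.ReflTransGen.lift
    (fun c : M.Config => ((c.1.elim x fun p => some (f p), c.2) : N.Config)) ?_ _ _ h
  rintro ⟨_ | q, s⟩ ⟨p, t⟩ hst
  · simp [step] at hst
  · simp only [step, Option.mem_def, Option.some.injEq, Prod.mk.injEq] at hst
    obtain ⟨rfl, rfl⟩ := hst
    simp [onFun, step, effect_eq, test_eq, target_eq]

/-- The one-state machine adding `e` to the counters. -/
def single (e : ℕ → ℤ) : CounterMachine where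
  State := Unit
  finite := inferInstance
  entry := ()
  effect _ := e
  test _ := 0
  target _ _ := none

/-- The machine that does nothing. -/
def skip : CounterMachine := single 0

/-- The machine incrementing the counter `r`. -/
def inc (r : ℕ) : CounterMachine := single (Pi.single r 1)

/-- Sequential composition. -/
def seq (M N : CounterMachine) : CounterMachine where
  State := M.State ⊕ N.State
  finite := have := M.finite; have := N.finite; inferInstance
  entry := .inl M.entry
  effect := Sum.elim M.effect N.effect
  test := Sum.elim M.test N.test
  target
    | .inl q, b => (M.target q b).elim (some (.inr N.entry)) fun p => some (.inl p)
    | .inr q, b => (N.target q b).elim none fun p => some (.inr p)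

/-- While the counter `r` is positive, decrement it and run `M`. The state `.inl false` is the head
of the loop and `.inl true` decrements. -/
def loop (r : ℕ) (M : CounterMachine) : CounterMachine where
  State := Bool ⊕ M.State
  finite := have := M.finite; inferInstance
  entry := .inl false
  effect := Sum.elim (fun b => if b then Pi.single r (-1) else 0) M.effect
  test := Sum.elim (fun _ => r) M.test
  target
    | .inl true, _ => some (.inr M.entry)
    | .inl false, true => some (.inl true)
    | .inl false, false => none
    | .inr q, b => (M.target q b).elim (some (.inl false)) fun p => some (.inr p)

theorem runs_skip (s : ℕ → ℕ) : Runs skip s s := by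
  refine .single (congrArg some (Prod.ext rfl (funext fun i => ?_)))
  simp [config, skip, single]

theorem runs_inc (r : ℕ) (s : ℕ → ℕ) : Runs (inc r) s (update s r (s r + 1)) := by
  refine .single (congrArg some (Prod.ext rfl (funext fun i => ?_)))
  by_cases h : i = r
  · subst h
    simp [config, inc, single]
  · simp [config, inc, single, h]

theorem Runs.seq {M N : CounterMachine} {s t u : ℕ → ℕ} (h₁ : M.Runs s t) (h₂ : N.Runs t u) :
    (M.seq N).Runs s u := by
  have h₁' := Reaches.embed (N := M.seq N) Sum.inl (some (.inr N.entry)) (fun _ => rfl)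
    (fun _ => rfl) (fun _ _ => rfl) h₁
  have h₂' := Reaches.embed (N := M.seq N) Sum.inr none (fun _ => rfl)
    (fun _ => rfl) (fun _ _ => rfl) h₂
  exact h₁'.trans h₂'

theorem runs_loop_zero {r : ℕ} {M : CounterMachine} {s : ℕ → ℕ} (h : s r = 0) :
    (loop r M).Runs s s := by
  refine .single (Option.mem_def.2 ?_)
  simp [step, config, loop, h]

/-- One round of the loop, ending at its head rather than at an exit, so that it also applies to
loops that never terminate. -/
theorem reaches_loop_entry {r : ℕ} {M : CounterMachine} {s t : ℕ → ℕ} (h : 0 < s r)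
    (hM : M.Runs (update s r (s r - 1)) t) :
    Reaches (loop r M).step ((loop r M).config (some (loop r M).entry) s)
      ((loop r M).config (some (loop r M).entry) t) := by
  have hM' := Reaches.embed (N := loop r M) Sum.inr (some (.inl false)) (fun _ => rfl)
    (fun _ => rfl) (fun _ _ => rfl) hM
  have h₁ : (loop r M).config (some (.inl true)) s ∈
      (loop r M).step ((loop r M).config (some (loop r M).entry) s) := by
    rw [Option.mem_def]
    simp [step, config, loop, h]
  have h₂ : (loop r M).config (some (.inr M.entry)) (update s r (s r - 1)) ∈
      (loop r M).step ((loop r M).config (some (.inl true)) s) := by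
    refine congrArg some (Prod.ext rfl (funext fun i => ?_))
    by_cases hi : i = r
    · subst hi
      simp only [config, loop, Sum.elim_inl, if_true, Pi.add_apply, Pi.single_eq_same,
        update_self]
      lia
    · simp [config, loop, hi]
  exact .head h₁ (.head h₂ hM')

theorem Runs.loop_step {r : ℕ} {M : CounterMachine} {s t u : ℕ → ℕ} (h : 0 < s r)
    (hM : M.Runs (update s r (s r - 1)) t) (hL : (loop r M).Runs t u) : (loop r M).Runs s u :=
  (reaches_loop_entry h hM).trans hL

/-- `τ k` describes the counters other than `r` after `k` rounds. The body must preserve every value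
`j` of `r`, so the number of rounds is fixed in advance. -/
theorem runs_loop {r : ℕ} {M : CounterMachine} (τ : ℕ → ℕ → ℕ) (n : ℕ)
    (h : ∀ k j, M.Runs (update (τ k) r j) (update (τ (k + 1)) r j)) :
    (loop r M).Runs (update (τ 0) r n) (update (τ n) r 0) := by
  induction n generalizing τ with
  | zero => exact runs_loop_zero (by simp)
  | succ n ih =>
    refine Runs.loop_step (t := update (τ 1) r n) (by simp) (by simpa using h 0 n) ?_
    exact ih (fun k => τ (k + 1)) fun k j => h (k + 1) j

theorem Runs.of_eq {M : CounterMachine} {s t s' t' : ℕ → ℕ} (h : M.Runs s t) (hs : s = s')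
    (ht : t = t') : M.Runs s' t' := hs ▸ ht ▸ h

/-- Set the counter `r` to zero. -/
def clear (r : ℕ) : CounterMachine := loop r skip

theorem runs_clear (r : ℕ) (s : ℕ → ℕ) : (clear r).Runs s (update s r 0) :=
  (runs_loop (fun _ => s) (s r) fun _ _ => runs_skip _).of_eq (by simp) rfl

/-- Add the counter `r` to the counter `o`, and set `r` to zero. -/
def move (r o : ℕ) : CounterMachine := loop r (inc o)

theorem runs_move {r o : ℕ} (h : r ≠ o) (s : ℕ → ℕ) :
    (move r o).Runs s (update (update s o (s o + s r)) r 0) := by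
  refine (runs_loop (fun k => update s o (s o + k)) (s r) fun k j => ?_).of_eq (by simp) rfl
  refine (runs_inc o _).of_eq rfl ?_
  ext i
  grind [update_apply]

/-- Add the counter `r` to the counter `o`, using the scratch counter `t`. -/
def addTo (r o t : ℕ) : CounterMachine := (loop r ((inc t).seq (inc o))).seq (move t r)

theorem runs_addTo {r o t : ℕ} (h₁ : r ≠ o) (h₂ : r ≠ t) (h₃ : o ≠ t) {s : ℕ → ℕ}
    (ht : s t = 0) : (addTo r o t).Runs s (update s o (s o + s r)) := by
  refine Runs.seq (t := update (update (update s o (s o + s r)) t (s r)) r 0) ?_ ?_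
  · refine (runs_loop (fun k => update (update s o (s o + k)) t k) (s r) fun k j => ?_).of_eq
      ?_ rfl
    · refine ((runs_inc t _).seq (runs_inc o _)).of_eq rfl ?_
      ext i
      grind [update_apply]
    · ext i
      grind [update_apply]
  · refine (runs_move h₂.symm _).of_eq rfl ?_
    ext i
    grind [update_apply]

end CounterMachine

-- Primitive recursive functions on counters

namespace CounterMachine

/-- `σ i s` gives the counters after `i` stages, as a function of the initial counters `s`. Only `s`
has to satisfy `p`; intermediate counters may violate it. -/
theorem exists_runs_iterate (σ : ℕ → (ℕ → ℕ) → ℕ → ℕ) (m : ℕ) (p : (ℕ → ℕ) → Prop)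
    (h₀ : ∀ s, p s → σ 0 s = s)
    (h : ∀ i < m, ∃ M : CounterMachine, ∀ s, p s → M.Runs (σ i s) (σ (i + 1) s)) :
    ∃ M : CounterMachine, ∀ s, p s → M.Runs s (σ m s) := by
  induction m with
  | zero => exact ⟨skip, fun s hs => (runs_skip s).of_eq rfl (h₀ s hs).symm⟩
  | succ m ih =>
    obtain ⟨M, hM⟩ := ih fun i hi => h i (by lia)
    obtain ⟨N, hN⟩ := h m (by lia)
    exact ⟨M.seq N, fun s hs => (hM s hs).seq (hN s hs)⟩

/-- `M.Computes f x o b`: the machine `M` adds the value of `f` on the counters `x` to the counter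
`o`, provided that the counters from `b` on are zero, and changes nothing else. -/
def Computes (M : CounterMachine) {n : ℕ} (f : List.Vector ℕ n → ℕ) (x : Fin n → ℕ) (o b : ℕ) :
    Prop :=
  ∀ s : ℕ → ℕ, (∀ r, b ≤ r → s r = 0) →
    M.Runs s (update s o (s o + f (List.Vector.ofFn fun i => s (x i))))

/-- `f` is computed by counter machines, for all choices of input, output and scratch counters. -/
def Computable {n : ℕ} (f : List.Vector ℕ n → ℕ) : Prop :=
  ∀ (x : Fin n → ℕ) (o b : ℕ), (∀ i, x i < b) → o < b → (∀ i, x i ≠ o) →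
    ∃ M : CounterMachine, M.Computes f x o b

theorem Computable.zero : Computable (n := 0) fun _ => 0 :=
  fun _ _ _ _ _ _ => ⟨skip, fun s _ => (runs_skip s).of_eq rfl (by simp)⟩

theorem Computable.get {n : ℕ} (i : Fin n) : Computable fun v => v.get i := by
  intro x o b hx ho hxo
  refine ⟨addTo (x i) o b, fun s hs => ?_⟩
  simpa using runs_addTo (hxo i) (hx i).ne ho.ne (hs b le_rfl)

theorem Computable.succ : Computable (n := 1) fun v => Nat.succ v.head := by
  intro x o b hx ho hxo
  refine ⟨(addTo (x 0) o b).seq (inc o), fun s hs => ?_⟩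
  refine ((runs_addTo (hxo 0) (hx 0).ne ho.ne (hs b le_rfl)).seq (runs_inc o _)).of_eq rfl ?_
  simp [List.Vector.ofFn, add_assoc]

theorem Computable.comp {m n : ℕ} {f : List.Vector ℕ n → ℕ} (g : Fin n → List.Vector ℕ m → ℕ)
    (hf : Computable f) (hg : ∀ i, Computable (g i)) :
    Computable fun a => f (List.Vector.ofFn fun i => g i a) := by
  intro x o b hx ho hxo
  -- The values of the `g i` are stored in the counters from `b` up to, but excluding, `b + n`, with
  -- scratch space beyond; `f` reads this block, which is then cleared.
  let G (s : ℕ → ℕ) (i : ℕ) : ℕ :=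
    if h : i < n then g ⟨i, h⟩ (List.Vector.ofFn fun i => s (x i)) else 0
  obtain ⟨M₁, hM₁⟩ := exists_runs_iterate
    (fun j s r => if b ≤ r ∧ r < b + j then G s (r - b) else s r) n
    (fun s => ∀ r, b ≤ r → s r = 0) (fun s _ => by ext r; grind) fun i hi => by
      obtain ⟨M, hM⟩ := hg ⟨i, hi⟩ x (b + i) (b + n) (fun i => by have := hx i; lia) (by lia)
        (fun i => by have := hx i; lia)
      refine ⟨M, fun s hs => (hM _ fun r hr => ?_).of_eq rfl ?_⟩
      · rw [if_neg (by lia), hs r (by lia)]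
      · have : (fun k => if b ≤ x k ∧ x k < b + i then G s (x k - b) else s (x k)) =
            fun k => s (x k) := by
          ext k
          rw [if_neg (by have := hx k; lia)]
        rw [this]
        ext r
        by_cases hr : r = b + i
        · subst hr
          simp [G, hi, hs]
        · rw [update_of_ne hr]
          exact if_congr (by lia) rfl rfl
  obtain ⟨M₂, hM₂⟩ := hf (fun i => b + i) o (b + n) (fun i => by lia) (by lia)
    (fun i => by lia)
  obtain ⟨M₃, hM₃⟩ := exists_runs_iterate
    (fun j s r => if b ≤ r ∧ r < b + j then 0 else s r) n
    (fun _ => True) (fun s _ => by ext r; grind) fun i hi =>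
      ⟨clear (b + i), fun s _ => (runs_clear _ _).of_eq rfl (by
        ext r
        by_cases hr : r = b + i
        · subst hr
          simp
        · rw [update_of_ne hr]
          exact if_congr (by lia) rfl rfl)⟩
  refine ⟨M₁.seq (M₂.seq M₃), fun s hs => ?_⟩
  refine ((hM₁ s hs).seq ((hM₂ _ fun r hr => ?_).seq (hM₃ _ trivial))).of_eq rfl ?_
  · rw [if_neg (by lia), hs r (by lia)]
  · have : (fun i : Fin n => if b ≤ b + i.val ∧ b + i.val < b + n then G s (b + i - b)
        else s (b + i)) = fun i => g i (List.Vector.ofFn fun i => s (x i)) := by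
      ext i
      simp [G]
    rw [this]
    ext r
    by_cases hr : r = o
    · subst hr
      simp [ho.not_ge]
    · by_cases hb : b ≤ r ∧ r < b + n
      · simp [hb, hr, hs]
      · simp [hb, hr]

theorem Computable.prec {n : ℕ} {f : List.Vector ℕ n → ℕ} {g : List.Vector ℕ (n + 2) → ℕ}
    (hf : Computable f) (hg : Computable g) :
    Computable fun v : List.Vector ℕ (n + 1) =>
      v.head.rec (f v.tail) fun y IH => g (y ::ᵥ IH ::ᵥ v.tail) := by
  intro x o b hx ho hxo
  obtain ⟨F, hF⟩ := hf (fun i => x i.succ) (b + 2) (b + 4)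
    (fun i => by have := hx i.succ; lia) (by lia) (fun i => by have := hx i.succ; lia)
  obtain ⟨G, hG⟩ := hg (Fin.cons (b + 1) (Fin.cons (b + 2) fun i => x i.succ)) (b + 3) (b + 4)
    (Fin.cases (by simp) (Fin.cases (by simp) fun i => by have := hx i.succ; simp; lia))
    (by lia)
    (Fin.cases (by simp) (Fin.cases (by simp) fun i => by have := hx i.succ; simp; lia))
  -- Counter `b` holds the remaining rounds, `b + 1` the recursion index, `b + 2` the current value,
  -- and `b + 3` receives the next value from `G`.
  refine ⟨(addTo (x 0) b (b + 1)).seq <| F.seq <|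
    (loop b <| G.seq <| (clear (b + 2)).seq <| (move (b + 3) (b + 2)).seq <| inc (b + 1)).seq <|
    (move (b + 2) o).seq <| clear (b + 1), fun s hs => ?_⟩
  have hx0 := hx 0
  set v := List.Vector.ofFn fun i : Fin n => s (x i.succ) with hv
  let h (k : ℕ) : ℕ := k.rec (f v) fun y IH => g (y ::ᵥ IH ::ᵥ v)
  -- Loop invariant: after `k` rounds the index is `k` and the stored value is `h k`.
  let τ (k : ℕ) : ℕ → ℕ := update (update s (b + 1) k) (b + 2) (h k)
  have h₁ := runs_addTo (r := x 0) (o := b) (t := b + 1) (by lia) (by lia) (by lia)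
    (hs (b + 1) (by lia))
  have h₂ : F.Runs (update s b (s b + s (x 0))) (update (τ 0) b (s (x 0))) := by
    refine (hF _ fun r hr => ?_).of_eq rfl ?_
    · rw [update_of_ne (by lia), hs r (by lia)]
    · have : (fun i : Fin n => update s b (s b + s (x 0)) (x i.succ)) = fun i => s (x i.succ) := by
        ext i
        rw [update_of_ne (hx i.succ).ne]
      rw [this, ← hv]
      ext r
      have := hs b le_rfl
      have := hs (b + 1) (by lia)
      have := hs (b + 2) (by lia)
      have h_zero : h 0 = f v := rfl
      simp only [τ, h_zero]
      grind [update_apply]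
  have h₃ := runs_loop (r := b) (M := G.seq <| (clear (b + 2)).seq <|
    (move (b + 3) (b + 2)).seq <| inc (b + 1)) τ (s (x 0)) fun k j => by
      refine ((hG _ fun r hr => ?_).seq ((runs_clear _ _).seq
        ((runs_move (by lia) _).seq (runs_inc _ _)))).of_eq rfl ?_
      · simp only [τ]
        rw [update_of_ne (by lia), update_of_ne (by lia), update_of_ne (by lia), hs r (by lia)]
      · have : (List.Vector.ofFn fun i : Fin (n + 2) => update (τ k) b j
            ((Fin.cons (b + 1) (Fin.cons (b + 2) fun i => x i.succ) : Fin (n + 2) → ℕ) i)) =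
            k ::ᵥ h k ::ᵥ v := by
          simp only [List.Vector.ofFn, Fin.cons_zero, Fin.cons_succ, hv]
          congr 1
          · simp [τ]
          congr 1
          · simp [τ]
          congr 1
          ext i
          have := hx i.succ
          simp only [τ]
          rw [update_of_ne (by lia), update_of_ne (by lia), update_of_ne (by lia)]
        rw [this]
        have h_succ : h (k + 1) = g (k ::ᵥ h k ::ᵥ v) := rfl
        rw [← h_succ]
        ext r
        have := hs (b + 3) (by lia)
        simp only [τ]
        grind [update_apply]
  refine (h₁.seq (h₂.seq (h₃.seq ((runs_move (by lia) _).seq (runs_clear _ _))))).of_eq rfl ?_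
  have : (List.Vector.ofFn fun i : Fin (n + 1) => s (x i)) = s (x 0) ::ᵥ v := rfl
  rw [this]
  change _ = update s o (s o + h (s (x 0)))
  ext r
  have := hs b le_rfl
  have := hs (b + 1) (by lia)
  have := hs (b + 2) (by lia)
  simp only [τ]
  grind [update_apply]

theorem computable_of_primrec {n : ℕ} {f : List.Vector ℕ n → ℕ} (hf : Primrec f) :
    Computable f := by
  have h := Nat.Primrec'.of_prim hf
  clear hf
  induction h with
  | zero => exact .zero
  | succ => exact .succ
  | get i => exact .get i
  | comp g _ _ hf hg => exact .comp g hf hg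
  | prec _ _ hf hg => exact .prec hf hg

end CounterMachine

-- Unbounded search

/-- Steps are deterministic, and since `c (k + 1) ≠ c k` each passage takes at least one step. The
run thus simulates the successor system on `ℕ`, which never halts. -/
theorem StateTransition.not_reaches_halting {σ : Type*} {f : σ → Option σ} {c : ℕ → σ} {a b : σ}
    (ha : Reaches f a (c 0)) (hc : ∀ k, Reaches f (c k) (c (k + 1)))
    (hne : ∀ k, c (k + 1) ≠ c k) (hb : f b = none) : ¬ Reaches f a b := by
  intro hab
  have H : Respects (fun k : ℕ => some (k + 1)) f (fun k a => a = c k) := by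
    rintro k _ rfl
    refine ⟨_, rfl, ?_⟩
    exact (Relation.reflTransGen_iff_eq_or_transGen.1 (hc k)).resolve_left (hne k)
  have h : (eval f (c 0)).Dom := by
    rw [← reaches_eval ha]
    exact Part.dom_iff_mem.2 ⟨b, mem_eval.2 ⟨hab, hb⟩⟩
  obtain ⟨k, hk⟩ := Part.dom_iff_mem.1 ((tr_eval_dom H rfl).1 h)
  exact Option.some_ne_none _ (mem_eval.1 hk).2

namespace CounterMachine

/-- Unbounded search for a zero of a primitive recursive function by a counter machine. -/
theorem exists_reaches_iff_exists_eq_zero {d : ℕ} {f : List.Vector ℕ (d + 1) → ℕ}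
    (hf : Primrec f) :
    ∃ M : CounterMachine, ∀ s : ℕ → ℕ, s 0 = 0 → (∀ r, d < r → s r = 0) →
      ((∃ t, Reaches M.step (M.config (some M.entry) s) (none, t)) ↔
        ∃ k, f (k ::ᵥ List.Vector.ofFn fun i : Fin d => s (i + 1)) = 0) := by
  classical
  -- The value of `f` is truncated to 0 or 1 because it serves as the loop flag: the decrement at
  -- the start of a round must reset the flag to zero.
  have hg : Primrec fun v => if f v = 0 then 0 else 1 :=
    Primrec.ite (Primrec.eq.comp hf (.const 0)) (.const 0) (.const 1)
  obtain ⟨P, hP⟩ := computable_of_primrec hg (fun i => i) (d + 1) (d + 2)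
    (fun i => by lia) (by lia) (fun i => by lia)
  -- Counter 0 is the candidate `k` and counter `d + 1` the flag. The flag is set once before the
  -- loop, so that `k = 0` gets tested.
  let L := loop (d + 1) (P.seq (inc 0))
  refine ⟨(inc (d + 1)).seq L, fun s h₀ hs => ?_⟩
  set v := List.Vector.ofFn fun i : Fin d => s (i + 1)
  let τ (k j : ℕ) : ℕ → ℕ := update (update s 0 k) (d + 1) j
  have body (k : ℕ) : (P.seq (inc 0)).Runs (τ k 0)
      (τ (k + 1) (if f (k ::ᵥ v) = 0 then 0 else 1)) := by
    refine ((hP _ fun r hr => ?_).seq (runs_inc _ _)).of_eq rfl ?_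
    · simp only [τ]
      rw [update_of_ne (by lia), update_of_ne (by lia), hs r (by lia)]
    · have : (List.Vector.ofFn fun i : Fin (d + 1) => τ k 0 i) = k ::ᵥ v := by
        simp only [List.Vector.ofFn]
        congr 1
        congr 1
        ext i
        simp only [τ, Fin.val_succ]
        rw [update_of_ne (by lia), update_of_ne (by lia)]
      simp only [this]
      generalize (if f (k ::ᵥ v) = 0 then 0 else 1) = y
      ext r
      have := hs (d + 1) (by lia)
      simp only [τ]
      grind [update_apply]
  have iter (k : ℕ) (hk : f (k ::ᵥ v) ≠ 0) : Reaches L.step (L.config (some L.entry) (τ k 1))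
      (L.config (some L.entry) (τ (k + 1) 1)) := by
    refine reaches_loop_entry (by simp [τ]) ?_
    simpa [τ, hk] using body k
  have start : (inc (d + 1)).Runs s (τ 0 1) := by
    refine (runs_inc _ _).of_eq rfl ?_
    have h₀' : update s 0 0 = s := update_eq_self_iff.2 h₀.symm
    simp [τ, hs, h₀']
  constructor
  · rintro ⟨t, ht⟩
    by_contra! hf0
    have start' := Reaches.embed (N := (inc (d + 1)).seq L) Sum.inl (some (.inr L.entry))
      (fun _ => rfl) (fun _ => rfl) (fun _ _ => rfl) start
    have iter' (k : ℕ) := Reaches.embed (N := (inc (d + 1)).seq L) Sum.inr none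
      (fun _ => rfl) (fun _ => rfl) (fun _ _ => rfl) (iter k (hf0 k))
    refine not_reaches_halting
      (c := fun k => ((inc (d + 1)).seq L).config (some (.inr L.entry)) (τ k 1))
      start' iter' (fun k h => ?_) rfl ht
    -- Counter 0 grows in every round, so the configurations at the loop head differ.
    have := congrFun (congrArg Prod.snd h) 0
    simp [config, τ] at this
  · intro hex
    have reach (k : ℕ) (hk : ∀ j < k, f (j ::ᵥ v) ≠ 0) :
        Reaches L.step (L.config (some L.entry) (τ 0 1)) (L.config (some L.entry) (τ k 1)) := by
      induction k with
      | zero => exact .refl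
      | succ k ih => exact (ih fun j hj => hk j (by lia)).trans (iter k (hk k (by lia)))
    refine ⟨_, start.seq (.trans (reach (Nat.find hex) fun j => Nat.find_min hex)
      (Runs.loop_step (t := τ (Nat.find hex + 1) 0) (by simp [τ]) ?_ (runs_loop_zero ?_)))⟩
    · simpa [τ, Nat.find_spec hex] using body (Nat.find hex)
    · simp [τ]

end CounterMachine

-- Linear combinations of letter counts in C-RASP

namespace CRASP

theorem Term.val_count_letter {Γ : Type u} [DecidableEq Γ] (a : Γ) (v : List Γ) :
    (Term.count (.letter a)).val v v.length = v.count a := by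
  simp only [Term.val, Formula.Holds]
  norm_cast
  induction v using List.reverseRecOn with
  | nil => simp
  | append_singleton v b ih =>
    have hfin : {j | 1 ≤ j ∧ j ≤ v.length ∧ 1 ≤ j ∧ v[j - 1]? = some a}.Finite :=
      (Set.finite_Iic v.length).subset fun j hj => hj.2.1
    have key (j : ℕ) (hj : 1 ≤ j ∧ j ≤ v.length) : (v ++ [b])[j - 1]? = v[j - 1]? :=
      List.getElem?_append_left (by lia)
    by_cases hb : b = a
    · subst hb
      have : {j | 1 ≤ j ∧ j ≤ (v ++ [b]).length ∧ 1 ≤ j ∧ (v ++ [b])[j - 1]? = some b} =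
          insert (v.length + 1) {j | 1 ≤ j ∧ j ≤ v.length ∧ 1 ≤ j ∧ v[j - 1]? = some b} := by
        ext j
        simp only [Set.mem_ofPred_eq, Set.mem_insert_iff, List.length_append, List.length_singleton]
        by_cases hj : j = v.length + 1
        · subst hj; simp
        · constructor
          · rintro ⟨h₁, h₂, -, h⟩
            exact .inr ⟨h₁, by lia, h₁, key j ⟨h₁, by lia⟩ ▸ h⟩
          · rintro (h | ⟨h₁, h₂, -, h⟩)
            · exact absurd h hj
            · exact ⟨h₁, by lia, h₁, (key j ⟨h₁, h₂⟩).trans h⟩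
      rw [this, Set.ncard_insert_of_notMem (by simp) hfin, ih]
      simp
    · have : {j | 1 ≤ j ∧ j ≤ (v ++ [b]).length ∧ 1 ≤ j ∧ (v ++ [b])[j - 1]? = some a} =
          {j | 1 ≤ j ∧ j ≤ v.length ∧ 1 ≤ j ∧ v[j - 1]? = some a} := by
        ext j
        simp only [Set.mem_ofPred_eq, List.length_append, List.length_singleton]
        by_cases hj : j = v.length + 1
        · subst hj; simp [hb]
        · constructor
          · rintro ⟨h₁, h₂, -, h⟩
            exact ⟨h₁, by lia, h₁, key j ⟨h₁, by lia⟩ ▸ h⟩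
          · rintro ⟨h₁, h₂, -, h⟩
            exact ⟨h₁, by lia, h₁, (key j ⟨h₁, h₂⟩).trans h⟩
      rw [this, ih]
      simp [hb]

theorem Formula.holds_letter {Γ : Type u} (a : Γ) (v : List Γ) :
    (Formula.letter a).Holds v v.length ↔ v.getLast? = some a := by
  rw [Formula.Holds, List.getLast?_eq_getElem?]
  cases v <;> simp

/-- The sum of `n` copies of a term. -/
def Term.nsmul {Γ : Type u} : ℕ → Term Γ → Term Γ
  | 0, _ => .const 0
  | n + 1, t => .add (nsmul n t) t

theorem Term.val_nsmul {Γ : Type u} (n : ℕ) (t : Term Γ) (v : List Γ) (i : ℕ) :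
    (t.nsmul n).val v i = n * t.val v i := by
  induction n with
  | zero => simp [nsmul, val]
  | succ n ih =>
    simp only [nsmul, val, ih]
    push_cast
    ring

/-- An integer multiple of a term. -/
def Term.zsmul {Γ : Type u} (c : ℤ) (t : Term Γ) : Term Γ :=
  .sub (t.nsmul c.toNat) (t.nsmul (-c).toNat)

theorem Term.val_zsmul {Γ : Type u} (c : ℤ) (t : Term Γ) (v : List Γ) (i : ℕ) :
    (t.zsmul c).val v i = c * t.val v i := by
  simp only [zsmul, val, val_nsmul]
  rw [← sub_mul, Int.toNat_sub_toNat_neg]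

/-- The sum of a list of terms. -/
def Term.sum {Γ : Type u} : List (Term Γ) → Term Γ
  | [] => .const 0
  | t :: l => .add t (sum l)

theorem Term.val_sum {Γ : Type u} (l : List (Term Γ)) (v : List Γ) (i : ℕ) :
    (Term.sum l).val v i = (l.map fun t => t.val v i).sum := by
  induction l with
  | nil => simp [sum, val]
  | cons t l ih => simp [sum, val, ih]

/-- The sum of the weights of the letters read so far. -/
noncomputable def Term.weightedCount {Γ : Type u} [Fintype Γ] (c : Γ → ℤ) : Term Γ :=
  .sum (Finset.univ.toList.map fun a => (Term.count (.letter a)).zsmul (c a))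

theorem Term.val_weightedCount {Γ : Type u} [Fintype Γ] (c : Γ → ℤ) (v : List Γ) :
    (Term.weightedCount c).val v v.length = (v.map c).sum := by
  classical
  simp only [weightedCount, val_sum, List.map_map, comp_def, val_zsmul, val_count_letter]
  rw [Finset.sum_map_toList, Finset.sum_list_map_count]
  -- Letters absent from `v` contribute zero, so the sum over the whole alphabet reduces to the
  -- letters of `v`.
  refine (Finset.sum_subset (Finset.subset_univ v.toFinset) fun a _ ha => ?_).symm.trans ?_
  · simp [List.count_eq_zero.2 fun h => ha (List.mem_toFinset.2 h)]
  · simp [mul_comm]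

/-- The conjunction of the negations of a list of formulas. -/
def Formula.none {Γ : Type u} : List (Formula Γ) → Formula Γ
  | [] => .lt (.const 0) (.const 1)
  | φ :: l => .and (.neg φ) (none l)

theorem Formula.holds_none {Γ : Type u} (l : List (Formula Γ)) (v : List Γ) (i : ℕ) :
    (Formula.none l).Holds v i ↔ ∀ φ ∈ l, ¬ φ.Holds v i := by
  induction l with
  | nil => simp [none, Holds, Term.val]
  | cons φ l ih => simp [none, Holds, ih]

/-- The rules determine the output `f` when every applicable rule outputs the value of `f` and some
rule applies whenever `f` has a value. -/
theorem CoT.next_eq {α : Type*} {Γ : Type u} (S : CoT α Γ) (v : List Γ) (o : Option Γ)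
    (sound : ∀ r ∈ S.rules, r.2.Holds v v.length → o = some r.1)
    (complete : ∀ a ∈ o, ∃ r ∈ S.rules, r.2.Holds v v.length) : S.next v = o := by
  classical
  unfold CoT.next
  cases hf : S.rules.find? fun r => decide (r.2.Holds v v.length) with
  | some r =>
    have hr := List.find?_some hf
    exact (sound r (List.mem_of_find?_eq_some hf) (by simpa using hr)).symm
  | none =>
    cases o with
    | none => rfl
    | some a =>
      obtain ⟨r, hr, hv⟩ := complete a rfl
      exact absurd hv (by simpa using List.find?_eq_none.1 hf r hr)

end CRASP

-- Simulation of a counter machine by a chain of thought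

namespace CounterMachine

open CRASP

variable (M : CounterMachine) (d : ℕ)

/-- The tokens used to simulate a counter machine: the input letters, the control states, and the
token `.inr none` signalling that the machine has exited. -/
abbrev Token : Type := Fin d ⊕ Option M.State

noncomputable instance : Fintype M.State := @Fintype.ofFinite _ M.finite

variable {d}

/-- The contribution of a token to the counters. The letter `i` counts for the counter `i + 1`. -/
def weight : M.Token d → ℕ → ℤ
  | .inl i => Pi.single (i + 1) 1
  | .inr (some q) => M.effect q
  | .inr none => 0

/-- The counters represented by a context. -/
def counters (v : List (M.Token d)) (r : ℕ) : ℤ :=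
  (v.map fun a => M.weight a r).sum

theorem counters_append (v : List (M.Token d)) (a : M.Token d) :
    M.counters (v ++ [a]) = M.counters v + M.weight a := by
  ext r
  simp [counters]

/-- The control state to be visited after a context. -/
noncomputable def control (v : List (M.Token d)) : Option M.State :=
  match v.getLast? with
  | some (.inr (some q)) => M.target q (decide (0 < M.counters v (M.test q)))
  | _ => some M.entry

/-- A term for the value of a counter. -/
noncomputable def counterTerm (r : ℕ) : Term (M.Token d) :=
  .weightedCount fun a => M.weight a r

theorem val_counterTerm (r : ℕ) (v : List (M.Token d)) :
    (M.counterTerm r).val v v.length = M.counters v r :=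
  Term.val_weightedCount _ v

/-- The chain of thought simulating a counter machine. -/
noncomputable def toCoT {α : Type*} (e : α ↪ Fin d) : CoT α (M.Token d) where
  embed := e.trans .inl
  rules :=
    (.inr (some M.entry),
      .none (Finset.univ.toList.map fun o : Option M.State => .letter (.inr o))) ::
    Finset.univ.toList.flatMap fun q : M.State =>
      [(.inr (M.target q true),
        .and (.letter (.inr (some q))) (.lt (.const 0) (M.counterTerm (M.test q)))),
       (.inr (M.target q false),
        .and (.letter (.inr (some q))) (.neg (.lt (.const 0) (M.counterTerm (M.test q)))))]
  accept := {.inr none}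

-- The guards are mutually exclusive, so the order of the rules is irrelevant: the first covers
-- contexts that are empty or end in an input letter, the others split on the last state and the
-- sign of its test. The last state's effect is already counted, matching a machine that tests after
-- updating.
open Classical in
theorem next_toCoT {α : Type*} (e : α ↪ Fin d) (v : List (M.Token d)) :
    (M.toCoT e).next v =
      if v.getLast? = some (.inr none) then none else some (.inr (M.control v)) := by
  refine CoT.next_eq _ _ _ ?_ ?_
  · simp only [toCoT, List.mem_cons, List.mem_flatMap, Finset.mem_toList, Finset.mem_univ,
      true_and, List.not_mem_nil, or_false]
    rintro r (rfl | ⟨q, rfl | rfl⟩) h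
    · simp only [Formula.holds_none, List.mem_map, Finset.mem_toList, Finset.mem_univ, true_and,
        forall_exists_index, forall_apply_eq_imp_iff, Formula.holds_letter] at h
      rw [if_neg (h none)]
      unfold control
      split
      · exact absurd ‹_› (h _)
      · rfl
    · simp only [Formula.Holds, Term.val, val_counterTerm] at h
      rw [← Formula.Holds, Formula.holds_letter] at h
      simp [control, h.1, h.2]
    · simp only [Formula.Holds, Term.val, val_counterTerm] at h
      rw [← Formula.Holds, Formula.holds_letter] at h
      simp [control, h.1, h.2]
  · intro a ha
    have hlast : v.getLast? ≠ some (.inr none) := fun h => by simp [h] at ha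
    by_cases h : ∃ q, v.getLast? = some (.inr (some q))
    · obtain ⟨q, hq⟩ := h
      by_cases hpos : 0 < M.counters v (M.test q)
      · refine ⟨_, List.mem_cons_of_mem _ (List.mem_flatMap.2 ⟨q, by simp, .head _⟩),
          (Formula.holds_letter _ _).2 hq, ?_⟩
        simpa [Formula.Holds, Term.val, val_counterTerm] using hpos
      · refine ⟨_, List.mem_cons_of_mem _ (List.mem_flatMap.2 ⟨q, by simp, .tail _ (.head _)⟩),
          (Formula.holds_letter _ _).2 hq, ?_⟩
        simpa [Formula.Holds, Term.val, val_counterTerm] using hpos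
    · refine ⟨_, List.mem_cons_self, (Formula.holds_none _ _ _).2 ?_⟩
      push Not at h
      simp only [List.mem_map, Finset.mem_toList, Finset.mem_univ, true_and,
        forall_exists_index, forall_apply_eq_imp_iff, Formula.holds_letter]
      exact Option.rec hlast h

theorem accepts_toCoT_iff {α : Type*} (e : α ↪ Fin d) (w : List α) :
    (M.toCoT e).Accepts w ↔
      ∃ t, Reaches M.step (some M.entry, M.counters (w.map (M.toCoT e).embed)) (none, t) := by
  have hlast₀ : (w.map (M.toCoT e).embed).getLast? ≠ some (.inr none) := by
    simp [List.getLast?_map, toCoT]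
  have hcontrol : M.control (w.map (M.toCoT e).embed) = some M.entry := by
    unfold control
    split
    · rename_i q h
      simp [List.getLast?_map, toCoT] at h
    · rfl
  have hstep (v : List (M.Token d)) (q : M.State) (h : M.control v = some q) :
      M.step (M.control v, M.counters v) =
        some (M.control (v ++ [.inr (some q)]), M.counters (v ++ [.inr (some q)])) := by
    rw [h]
    simp [step, control, counters_append, weight]
  rw [← hcontrol]
  constructor
  · rintro ⟨v, a, hv, hnext, ha⟩
    obtain rfl : a = .inr none := ha
    -- Until the exit token is written, the context encodes a reachable configuration.
    have key : v.getLast? = some (.inr none) ∨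
        Reaches M.step (M.control (w.map (M.toCoT e).embed), M.counters (w.map (M.toCoT e).embed))
          (M.control v, M.counters v) := by
      clear hnext
      induction hv with
      | refl => exact .inr .refl
      | tail _ hs ih =>
        obtain ⟨a, hn, rfl⟩ := hs
        rename_i v _
        rw [next_toCoT] at hn
        split at hn
        · simp at hn
        · rename_i hl
          cases hc : M.control v with
          | none =>
            left
            simp only [hc, Option.some.injEq] at hn
            simp [← hn]
          | some q =>
            right
            simp only [hc, Option.some.injEq] at hn
            subst hn
            exact (ih.resolve_left hl).tail (hstep v q hc)
    rw [next_toCoT] at hnext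
    split at hnext
    · simp at hnext
    · rename_i hl
      have hc : M.control v = none := by simpa using hnext
      exact ⟨_, hc ▸ key.resolve_left hl⟩
  · rintro ⟨t, ht⟩
    -- Conversely, every reachable configuration is encoded by a reachable context without a final
    -- exit token.
    have key (c : M.Config) (hc : Reaches M.step
        (M.control (w.map (M.toCoT e).embed), M.counters (w.map (M.toCoT e).embed)) c) :
        ∃ v, Relation.ReflTransGen (M.toCoT e).Step (w.map (M.toCoT e).embed) v ∧
          v.getLast? ≠ some (.inr none) ∧ c = (M.control v, M.counters v) := by
      induction hc with
      | refl => exact ⟨_, .refl, hlast₀, rfl⟩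
      | tail _ hs ih =>
        obtain ⟨v, hv, hl, rfl⟩ := ih
        cases hc : M.control v with
        | none => simp [step, hc] at hs
        | some q =>
          rw [hstep v q hc] at hs
          refine ⟨v ++ [.inr (some q)], hv.tail ⟨_, ?_, rfl⟩, by simp, (Option.some.inj hs).symm⟩
          rw [next_toCoT, if_neg hl, hc]
    obtain ⟨v, hv, hl, hc⟩ := key _ ht
    refine ⟨v, .inr none, hv, ?_, rfl⟩
    have hc' : none = M.control v := congrArg Prod.fst hc
    rw [next_toCoT, if_neg hl, ← hc']

theorem counters_map_embed {α : Type*} (e : α ↪ Fin d) (w : List α) :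
    M.counters (w.map (M.toCoT e).embed) =
      fun r => ((((w.map e).map fun i : Fin d => (i : ℕ) + 1).count r : ℕ) : ℤ) := by
  induction w using List.reverseRecOn with
  | nil => ext r; simp [counters]
  | append_singleton w a ih =>
    rw [List.map_append, List.map_singleton, counters_append, ih]
    ext r
    simp [toCoT, weight, List.count_singleton, Pi.single_apply, eq_comm (a := r)]

end CounterMachine

-- Recursively enumerable permutation-invariant languages

/-- Bounding the evaluation by `k` makes the test primitive recursive; the only unbounded search
left is over `k`. -/
theorem IsRE.exists_code {α : Type*} [Primcodable α] {L : Language α} (hL : IsRE L) :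
    ∃ c : Nat.Partrec.Code, ∀ w : List α,
      w ∈ L ↔ ∃ k, (Nat.Partrec.Code.evaln k c (Encodable.encode w)).isSome := by
  obtain ⟨c, hc⟩ := Nat.Partrec.Code.exists_code.1 hL
  refine ⟨c, fun w => ?_⟩
  have h : w ∈ L ↔ (c.eval (Encodable.encode w)).Dom := by
    rw [hc]
    simp [Part.assert]
  rw [h, Part.dom_iff_mem]
  simp only [Nat.Partrec.Code.evaln_complete, Option.isSome_iff_exists, Option.mem_def]
  exact exists_comm

/-- The word in which, for each `i` in turn, the letter `a i` occurs `v i` times. -/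
def wordOfCounts {α : Type*} {d : ℕ} (a : Fin d → α) (v : List.Vector ℕ d) : List α :=
  (List.finRange d).flatMap fun i => (List.range (v.get i)).map fun _ => a i

theorem primrec_wordOfCounts {α : Type*} [Primcodable α] {d : ℕ} (a : Fin d → α) :
    Primrec (wordOfCounts a) :=
  Primrec.list_flatMap (.const _) <| Primrec.list_map
    (Primrec.list_range.comp (Primrec.vector_get.comp .fst .snd))
    ((Primrec.dom_finite a).comp (Primrec.snd.comp .fst))

theorem count_wordOfCounts {α : Type*} [DecidableEq α] {d : ℕ} (e : α ≃ Fin d)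
    (v : List.Vector ℕ d) (x : α) : (wordOfCounts e.symm v).count x = v.get (e x) := by
  have h (i : Fin d) : List.count x (List.replicate (v.get i) (e.symm i)) =
      if i = e x then v.get i else 0 := by
    rw [List.count_replicate]
    exact if_congr (by simp [Equiv.symm_apply_eq]) rfl rfl
  simp only [wordOfCounts, List.count_flatMap, comp_def, List.map_const', List.length_range, h]
  rw [← List.ofFn_eq_map, List.sum_ofFn]
  simp

theorem IsPermutationInvariant.isRecognizable {α : Type*} [Finite α] [DecidableEq α]
    [Primcodable α] {L : Language α} (hL : IsRE L) (hperm : IsPermutationInvariant L) :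
    CRASP.IsRecognizable L := by
  classical
  obtain ⟨d, ⟨e⟩⟩ := Finite.exists_equiv_fin α
  obtain ⟨c, hc⟩ := hL.exists_code
  let f (v : List.Vector ℕ (d + 1)) : ℕ :=
    if (Nat.Partrec.Code.evaln v.head c
      (Encodable.encode (wordOfCounts e.symm v.tail))).isSome then 0 else 1
  have hf : Primrec f := by
    refine Primrec.ite (Primrec.eq.comp (Primrec.option_isSome.comp
      (Nat.Partrec.Code.primrec_evaln.comp (.pair (.pair .vector_head (.const c)) ?_)))
      (.const true)) (.const 0) (.const 1)
    exact Primrec.encode.comp ((primrec_wordOfCounts _).comp .vector_tail)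
  obtain ⟨M, hM⟩ := CounterMachine.exists_reaches_iff_exists_eq_zero hf
  have := M.finite
  refine ⟨M.Token d, inferInstance, M.toCoT e.toEmbedding, fun w => ?_⟩
  rw [M.accepts_toCoT_iff, M.counters_map_embed]
  -- The initial counters: letter `i` is counted in `i + 1`, leaving counter 0 free for the search.
  let s (r : ℕ) : ℕ := ((w.map e).map fun i : Fin d => (i : ℕ) + 1).count r
  have hs (i : Fin d) : s (i + 1) = w.count (e.symm i) := by
    have hinj : Injective fun i : Fin d => (i : ℕ) + 1 := fun i j h => by
      simpa [Fin.ext_iff] using h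
    rw [← List.count_map_of_injective w e e.injective, e.apply_symm_apply]
    exact List.count_map_of_injective (w.map e) _ hinj i
  have hs₀ (r : ℕ) (hr : r = 0 ∨ d < r) : s r = 0 := by
    refine List.count_eq_zero.2 fun h => ?_
    obtain ⟨i, -, rfl⟩ := List.mem_map.1 h
    lia
  refine Iff.trans ?_ (hM s (hs₀ 0 (.inl rfl)) fun r hr => hs₀ r (.inr hr)).symm
  -- Permutation invariance enters here: `w` is replaced by the canonical word with its Parikh
  -- vector.
  rw [hperm w (wordOfCounts e.symm (List.Vector.ofFn fun i => s (i + 1)))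
    (funext fun x => by simp [parikh, count_wordOfCounts, hs]), hc]
  simp [f, Option.isSome_iff_ne_none]

/-- Over at most one letter a word is determined by its length. -/
theorem Language.isPermutationInvariant_of_subsingleton {α : Type*} [Subsingleton α]
    [DecidableEq α] (L : Language α) : IsPermutationInvariant L := by
  intro u v h
  have huv : u.Perm v := List.perm_iff_count.2 (congrFun h)
  rw [List.ext_getElem huv.length_eq fun _ _ _ => Subsingleton.elim _ _]

theorem mainTheorem1 :
    (∀ (α : Type u) [Finite α] [DecidableEq α] [Primcodable α] (L : Language α),
      IsRE L → IsPermutationInvariant L → CRASP.IsRecognizable L) ∧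
    (∀ L : Language Unit, IsRE L → CRASP.IsRecognizable L) :=
  ⟨fun _ _ _ _ _ hL hperm => hperm.isRecognizable hL,
    fun L hL => L.isPermutationInvariant_of_subsingleton.isRecognizable hL⟩
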